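/- There is an absolute constant $c>0$ such that the following holds for all integers $n,r,k,s$ with $2\le r\le n/2+1$ and $0\le k\le\sum_{i=0}^{r}\binom ni$ (the number of possible hyperedges of arity at most $r$), and every $\epsilon\in(0,1)$. A stream of hyperedges on the vertex set $V$, $|V|=n$, is a finite sequence of insertions of hyperedges $e\subseteq V$ not currently present and deletions of hyperedges currently present, starting from the hypergraph without hyperedges; it is a $k$-bounded-deletion stream if at most $k$ of its updates are deletions. A $(1\pm\epsilon)$ cut-sparsifier of the resulting (unweighted) hypergraph $H$ is a sub-hypergraph $\hat H$ of $H$ with nonnegative hyperedge weights such that for every $S\subseteq V$ the total weight in $\hat H$ of the hyperedges meeting both $S$ and $V\setminus S$ lies between $(1-\epsilon)$ and $(1+\epsilon)$ times the number of such hyperedges of $H$. Suppose that a randomized one-pass streaming algorithm with $s$ bits of memory, on every $k$-bounded-deletion stream of hyperedges of arity at most $r$ on $n$ vertices, outputs with probability at least $2/3$ a $(1\pm\epsilon)$ cut-sparsifier of the resulting hypergraph. Then $$ s\;\ge\; c\,n\,r\,\log_2(k/n), $$ that is, the algorithm uses $\Omega(nr\log(k/n))$ bits of space. (The right side is read as $0$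 if $k=0$. The algorithm may be nonuniform, and its random tape, a clock counting the updates, and its computation time are not charged.) -/

import Mathlib

open MeasureTheory
open scoped NNReal ENNReal

universe u

namespace HypergraphStream

/-- An (unweighted) hypergraph on the vertex set `Fin n`, given by its finite set of distinct
hyperedges; a hyperedge is an arbitrary set of vertices. -/
abbrev Hypergraph (n : ℕ) : Type := Finset (Finset (Fin n))

/-- A hypergraph on `Fin n` with nonnegative hyperedge weights (only the weights of members of
`edges` are ever used). -/
structure WeightedHypergraph (n : ℕ) where
  edges : Hypergraph n
  weight : Finset (Fin n) → ℝ≥0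

/-- An unweighted hypergraph is regarded as a weighted one with all weights equal to `1`. -/
def Hypergraph.toWeighted {n : ℕ} (H : Hypergraph n) : WeightedHypergraph n where
  edges := H
  weight := fun _ => 1

/-- The hyperedge `e` crosses the cut `(S, Sᶜ)`. -/
def Crosses {n : ℕ} (S e : Finset (Fin n)) : Prop :=
  (e ∩ S).Nonempty ∧ (e ∩ Sᶜ).Nonempty

instance {n : ℕ} (S : Finset (Fin n)) : DecidablePred (Crosses S) :=
  fun e => inferInstanceAs (Decidable ((e ∩ S).Nonempty ∧ (e ∩ Sᶜ).Nonempty))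

/-- The total weight of the hyperedges of `H` that cross the cut `(S, Sᶜ)`. -/
def WeightedHypergraph.cutWeight {n : ℕ} (H : WeightedHypergraph n) (S : Finset (Fin n)) : ℝ :=
  ∑ e ∈ H.edges.filter (Crosses S), (H.weight e : ℝ)

/-- `G` is a `(1 ± ε)` cut-sparsifier of `H`: a reweighted sub-hypergraph of `H` in which every
cut has, up to a factor in `[1 - ε, 1 + ε]`, the weight that it has in `H`. -/
structure IsCutSparsifier {n : ℕ} (ε : ℝ) (G : WeightedHypergraph n) (H : Hypergraph n) :
    Prop where
  edges_subset : G.edges ⊆ H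
  lower : ∀ S : Finset (Fin n), (1 - ε) * H.toWeighted.cutWeight S ≤ G.cutWeight S
  upper : ∀ S : Finset (Fin n), G.cutWeight S ≤ (1 + ε) * H.toWeighted.cutWeight S

/-- One element of a stream: the insertion or the deletion of a hyperedge. -/
inductive Update (n : ℕ) where
  | insert (e : Finset (Fin n)) : Update n
  | delete (e : Finset (Fin n)) : Update n

namespace Update

variable {n : ℕ}

/-- The hyperedge concerned by an update. -/
def edge : Update n → Finset (Fin n)
  | insert e => e
  | delete e => e

/-- Whether an update is a deletion. -/
def isDeletion : Update n → Bool
  | insert _ => false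
  | delete _ => true

/-- The effect of an update on the current hypergraph. -/
def apply (H : Hypergraph n) : Update n → Hypergraph n
  | insert e => Insert.insert e H
  | delete e => Finset.erase H e

/-- Only new hyperedges are inserted and only existing hyperedges are deleted. -/
def Legal (H : Hypergraph n) : Update n → Prop
  | insert e => e ∉ H
  | delete e => e ∈ H

end Update

/-- The hypergraph that a stream (starting from the hypergraph without hyperedges) results in. -/
def finalHypergraph {n : ℕ} (L : List (Update n)) : Hypergraph n :=
  L.foldl Update.apply ∅

/-- Every update of the stream is legal at the time at which it arrives, when the stream starts
from the hypergraph `H`. -/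
def LegalFrom {n : ℕ} : Hypergraph n → List (Update n) → Prop
  | _, [] => True
  | H, a :: L => a.Legal H ∧ LegalFrom (a.apply H) L

/-- `L` is a `k`-bounded-deletion stream of hyperedges of arity at most `r` on `Fin n`. -/
structure IsBoundedDeletionStream {n : ℕ} (k r : ℕ) (L : List (Update n)) : Prop where
  legal : LegalFrom ∅ L
  arity_le : ∀ a ∈ L, a.edge.card ≤ r
  deletions_le : L.countP Update.isDeletion ≤ k

/-- The contents of a memory of `s` bits. -/
abbrev Memory (s : ℕ) : Type := Fin s → Bool

/-- A randomized one-pass streaming algorithm that uses `s` bits of space on streams of hyperedges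
on `Fin n` and outputs a weighted hypergraph.  Only the `s` bits of memory are kept between two
updates.  The algorithm may be nonuniform, and neither its computation time, nor its random
tape `ω`, nor a clock that counts the updates, are charged (the clock lets each step use fresh
randomness from the tape). -/
structure StreamingAlgorithm (n s : ℕ) where
  /-- the possible contents of the random tape -/
  Tape : Type u
  [tapeSpace : MeasurableSpace Tape]
  /-- the distribution of the random tape -/
  law : Measure Tape
  [law_prob : IsProbabilityMeasure law]
  /-- the initial memory -/
  init : Tape → Memory s
  /-- the new memory, from the tape, the number of updates so far, the memory and the update -/
  step : Tape → ℕ → Memory s → Update n → Memory s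
  /-- the output, from the tape, the length of the stream and the memory at its end -/
  output : Tape → ℕ → Memory s → WeightedHypergraph n

namespace StreamingAlgorithm

variable {n s : ℕ}

/-- The memory after reading a stream, started at time `t` with memory `m`. -/
def runFrom (A : StreamingAlgorithm.{u} n s) (ω : A.Tape) :
    ℕ → Memory s → List (Update n) → Memory s
  | _, m, [] => m
  | t, m, a :: L => A.runFrom ω (t + 1) (A.step ω t m a) L

/-- The output of the algorithm on the stream `L` with random tape `ω`. -/
def result (A : StreamingAlgorithm.{u} n s) (ω : A.Tape) (L : List (Update n)) :
    WeightedHypergraph n :=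
  A.output ω L.length (A.runFrom ω 0 (A.init ω) L)

/-- On the stream `L` the algorithm outputs, with probability at least `2/3`, a `(1 ± ε)`
cut-sparsifier of the resulting hypergraph. -/
def SucceedsOn (A : StreamingAlgorithm.{u} n s) (ε : ℝ) (L : List (Update n)) : Prop :=
  ∃ good : Set A.Tape, @MeasurableSet A.Tape A.tapeSpace good ∧
    (2 / 3 : ℝ≥0∞) ≤ A.law good ∧
    ∀ ω ∈ good, IsCutSparsifier ε (A.result ω L) (finalHypergraph L)

/-- The algorithm produces `(1 ± ε)` cut-sparsifiers of hypergraphs on `Fin n` of arity at most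
`r` that are given by `k`-bounded-deletion streams. -/
def Sparsifies (A : StreamingAlgorithm.{u} n s) (k r : ℕ) (ε : ℝ) : Prop :=
  ∀ L : List (Update n), IsBoundedDeletionStream k r L → A.SucceedsOn ε L

end StreamingAlgorithm

end HypergraphStream

namespace HypergraphStream

/-! Fix a set `B` of about `3n/4` vertices and put `d = r - 1`. Each vertex `v` outside `B` gets a
uniformly random sequence of `K` distinct `d`-subsets of `B`, each of which is joined to `v` as a
hyperedge. The stream inserts all of them and then deletes those at one `v` with index larger than
`i`. A sparsifier must retain a hyperedge in the cut `{v}`, hence names one of the first `i + 1`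
subsets at `v`. The memory after the insertions depends on the sets of hyperedges only, not on their
order, so by symmetry the named subset is the `i`-th with conditional probability `1 / (i + 1)`
(`card_filter_exists_le`).

The memory thus allows the sequences to be guessed backwards, with at least `(2/3) |V| H_K` correct
guesses on average, where `V` is the complement of `B` and `H_K` the harmonic sum. Without
information a guess succeeds with probability about `K / u` at most, with `u = (|B| choose d)`; so
each hit is worth `log P` for `P = (u - K) / K`. The exponential moment of the number of hits
(`sum_prod_guess_le_exp`), a sum over all memory contents and Jensen's inequality make this precise
in `log_card_message_ge`.

For `K = min k √u` one has `H_K ≳ log k` and `log P ≳ log u ≳ r`, whence `s ≳ n r log k`. This is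
stronger than required, since only one vertex suffers deletions. -/

/-! ### Guessing random injections from a short message -/

/-- Swapping two values of the `v`-th injection of a family of injections. -/
def swapAt {V U : Type*} [DecidableEq V] {K : ℕ} (v : V) (j i : Fin K)
    (x : V → Fin K ↪ U) : V → Fin K ↪ U :=
  Function.update x v ((Equiv.swap j i).toEmbedding.trans (x v))

theorem swapAt_swapAt {V U : Type*} [DecidableEq V] {K : ℕ} (v : V) (j i : Fin K)
    (x : V → Fin K ↪ U) : swapAt v j i (swapAt v j i x) = x := by
  funext w
  by_cases h : w = v
  · subst h
    ext a
    simp [swapAt]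
  · simp [swapAt, h]

theorem map_swapAt_Ioi {V U : Type*} [DecidableEq V] {K : ℕ} (v : V) {j i : Fin K} (hji : j ≤ i)
    (x : V → Fin K ↪ U) :
    (Finset.Ioi i).map (swapAt v j i x v) = (Finset.Ioi i).map (x v) := by
  classical
  have h : ∀ a ∈ Finset.Ioi i, swapAt v j i x v a = x v a := by
    intro a ha
    rw [Finset.mem_Ioi] at ha
    have h1 : a ≠ j := (hji.trans_lt ha).ne'
    simp [swapAt, Equiv.swap_apply_of_ne_of_ne h1 ha.ne']
  rw [Finset.map_eq_image, Finset.map_eq_image]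
  exact Finset.image_congr h

/-- A guess that does not distinguish between the first `i + 1` values of an injection, and that
is one of them, is the `i`-th one with probability at least `1 / (i + 1)`. -/
theorem card_filter_exists_le {V U : Type*} [Fintype V] [DecidableEq V] [Fintype U]
    [DecidableEq U] {K : ℕ} (v : V) (i : Fin K) (y : (V → Fin K ↪ U) → Option U)
    (hy : ∀ x j, j ≤ i → y (swapAt v j i x) = y x) :
    (Finset.univ.filter fun x : V → Fin K ↪ U => ∃ j ≤ i, y x = some (x v j)).card ≤
      ((i : ℕ) + 1) * (Finset.univ.filter fun x : V → Fin K ↪ U => y x = some (x v i)).card := by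
  have h1 : (Finset.univ.filter fun x : V → Fin K ↪ U => ∃ j ≤ i, y x = some (x v j)) ⊆
      (Finset.Iic i).biUnion fun j =>
        Finset.univ.filter fun x : V → Fin K ↪ U => y x = some (x v j) := by
    intro x hx
    simpa using hx
  refine (Finset.card_le_card h1).trans (Finset.card_biUnion_le.trans ?_)
  rw [← Fin.card_Iic i, ← smul_eq_mul]
  refine Finset.sum_le_card_nsmul _ _ _ fun j hj => ?_
  rw [Finset.mem_Iic] at hj
  -- The swap is an involution that leaves the guess unchanged and moves the `j`-th value to place
  -- `i`, so a hit at `j` is at most as frequent as a hit at `i`.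
  refine Finset.card_le_card_of_injOn (swapAt v j i) ?_ ?_
  · intro x hx
    simp only [Finset.coe_filter, Finset.mem_univ, true_and, Set.mem_ofPred_eq] at hx ⊢
    rw [hy x j hj, hx]
    simp [swapAt]
  · exact (Function.LeftInverse.injective (swapAt_swapAt v j i)).injOn

theorem sum_guess_le {U : Type*} [Fintype U] [DecidableEq U] {P : ℝ} (hP : 1 ≤ P)
    (p : U → Prop) [DecidablePred p] (y : Option U) :
    ∑ x : {x // p x}, (if y = some (x : U) then P else 1) ≤ Fintype.card {x // p x} + P := by
  have h : ∀ x : {x // p x}, (if y = some (x : U) then P else 1) ≤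
      1 + (if y = some (x : U) then P else 0) := by
    intro x
    split_ifs <;> linarith
  refine (Finset.sum_le_sum fun x _ => h x).trans ?_
  rw [Finset.sum_add_distrib]
  have h2 : ∑ x : {x // p x}, (if y = some (x : U) then P else 0) ≤ P := by
    rw [← Finset.sum_filter, Finset.sum_const, nsmul_eq_mul]
    have : (Finset.univ.filter fun x : {x // p x} => y = some (x : U)).card ≤ 1 := by
      rw [Finset.card_le_one]
      intro a ha b hb
      simp only [Finset.mem_filter, Finset.mem_univ, true_and] at ha hb
      exact Subtype.ext (Option.some.inj (ha.symm.trans hb))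
    have h3 : ((Finset.univ.filter fun x : {x // p x} => y = some (x : U)).card : ℝ) ≤ 1 := by
      exact_mod_cast this
    nlinarith
  simpa using h2

/-- The exponential moment of the number of correct guesses of successive values of a random
injection, each guess being based on the values that were revealed before. -/
theorem sum_prod_guess_le {U : Type*} [Fintype U] [DecidableEq U] {P : ℝ} (hP : 1 ≤ P) (K : ℕ)
    (g : Fin K → Finset U → Option U) (hK : K ≤ Fintype.card U) :
    ∑ f : Fin K ↪ U, ∏ i, (if g i ((Finset.Ioi i).map f) = some (f i) then P else 1) ≤
      ∏ i ∈ Finset.range K, ((Fintype.card U : ℝ) - i + P) := by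
  induction K with
  | zero => simp
  | succ K ih =>
    -- The value at `0` is revealed last: given the other `K` values it ranges over the `|U| - K`
    -- remaining points, at most one of which is the guess.
    rw [← Equiv.sum_comp (Equiv.embeddingFinSucc K U).symm, Fintype.sum_sigma,
      Finset.prod_range_succ]
    have key : ∀ (e : Fin K ↪ U) (x : {x // x ∉ Set.range e}),
        ∏ i, (if g i ((Finset.Ioi i).map ((Equiv.embeddingFinSucc K U).symm ⟨e, x⟩)) =
          some ((Equiv.embeddingFinSucc K U).symm ⟨e, x⟩ i) then P else 1) =
        (∏ i : Fin K, (if g i.succ ((Finset.Ioi i).map e) = some (e i) then P else 1)) *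
          (if g 0 (Finset.univ.map e) = some (x : U) then P else 1) := by
      intro e x
      have h0 : (Finset.Ioi (0 : Fin (K + 1))).map ((Equiv.embeddingFinSucc K U).symm ⟨e, x⟩) =
          Finset.univ.map e := by
        rw [Fin.Ioi_zero_eq_map, Finset.map_map]
        congr 1
      have h1 : ∀ i : Fin K, (Finset.Ioi i.succ).map ((Equiv.embeddingFinSucc K U).symm ⟨e, x⟩) =
          (Finset.Ioi i).map e := by
        intro i
        rw [← Fin.map_succEmb_Ioi, Finset.map_map]
        congr 1
      rw [Fin.prod_univ_succ, mul_comm]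
      simp only [h0, h1]
      simp
    simp only [key, ← Finset.mul_sum]
    have hcard : ∀ e : Fin K ↪ U,
        (Fintype.card {x // x ∉ Set.range e} : ℝ) = Fintype.card U - K := by
      intro e
      rw [Fintype.card_subtype_compl, Nat.cast_sub (Fintype.card_subtype_le _)]
      congr 2
      exact (Fintype.card_congr (Equiv.ofInjective e e.injective).symm).trans (Fintype.card_fin K)
    have hnn : (0 : ℝ) ≤ (Fintype.card U : ℝ) - K + P := by
      have : (K : ℝ) + 1 ≤ Fintype.card U := by exact_mod_cast hK
      linarith
    calc _ ≤ ∑ e : Fin K ↪ U,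
          (∏ i : Fin K, (if g i.succ ((Finset.Ioi i).map e) = some (e i) then P else 1)) *
            ((Fintype.card U : ℝ) - K + P) := by
          refine Finset.sum_le_sum fun e _ => mul_le_mul_of_nonneg_left ?_ ?_
          · rw [← hcard e]
            exact sum_guess_le hP _ _
          · exact Finset.prod_nonneg fun i _ => by split_ifs <;> linarith
      _ ≤ _ := by
          rw [← Finset.sum_mul]
          exact mul_le_mul_of_nonneg_right (ih (fun i => g i.succ) (by omega)) hnn

/-- Relative to the number of injections, the `i`-th factor is `1 + P / (|U| - i)`, which `hK`
bounds by `1 + 1 / K ≤ exp (1 / K)`; there are `K` such factors. -/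
theorem sum_prod_guess_le_exp {U : Type*} [Fintype U] [DecidableEq U] {P : ℝ} (hP : 1 ≤ P)
    (K : ℕ) (hK : K * P ≤ (Fintype.card U : ℝ) - K) (g : Fin K → Finset U → Option U) :
    ∑ f : Fin K ↪ U, ∏ i, (if g i ((Finset.Ioi i).map f) = some (f i) then P else 1) ≤
      Real.exp 1 * Fintype.card (Fin K ↪ U) := by
  have hK0 : (0 : ℝ) ≤ K := K.cast_nonneg
  have hle : (K : ℝ) ≤ Fintype.card U := by nlinarith
  have hle' : K ≤ Fintype.card U := by exact_mod_cast hle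
  refine (sum_prod_guess_le hP K g hle').trans ?_
  rcases Nat.eq_zero_or_pos K with rfl | hpos
  · simp
  have hKpos : (0 : ℝ) < K := by exact_mod_cast hpos
  have hcard : (Fintype.card (Fin K ↪ U) : ℝ) =
      ∏ i ∈ Finset.range K, ((Fintype.card U : ℝ) - i) := by
    rw [Fintype.card_embedding_eq, Fintype.card_fin, Nat.descFactorial_eq_prod_range,
      Nat.cast_prod]
    refine Finset.prod_congr rfl fun i hi => ?_
    rw [Finset.mem_range] at hi
    rw [Nat.cast_sub (by omega)]
  have hexp : Real.exp 1 = ∏ i ∈ Finset.range K, Real.exp (1 / K) := by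
    rw [Finset.prod_const, Finset.card_range, ← Real.exp_nat_mul]
    congr 1
    field_simp
  rw [hcard, hexp, ← Finset.prod_mul_distrib]
  refine Finset.prod_le_prod (fun i hi => ?_) fun i hi => ?_
  · have : (i : ℝ) < K := by exact_mod_cast Finset.mem_range.1 hi
    linarith
  · have hi' : (i : ℝ) < K := by exact_mod_cast Finset.mem_range.1 hi
    have h1 : P ≤ (1 / K) * ((Fintype.card U : ℝ) - i) := by
      rw [one_div, inv_mul_eq_div, le_div_iff₀ hKpos]
      linarith
    have h2 := Real.add_one_le_exp (1 / (K : ℝ))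
    nlinarith [mul_le_mul_of_nonneg_right h2 (by linarith : (0 : ℝ) ≤ (Fintype.card U : ℝ) - i)]

/-- Jensen's inequality for the exponential function and the uniform distribution. -/
theorem card_mul_exp_le_sum_exp {X : Type*} [Fintype X] (h : X → ℝ) {a : ℝ}
    (ha : Fintype.card X * a ≤ ∑ x, h x) :
    Fintype.card X * Real.exp a ≤ ∑ x, Real.exp (h x) := by
  have h1 : ∀ x, Real.exp a * (h x - a + 1) ≤ Real.exp (h x) := by
    intro x
    calc _ ≤ Real.exp a * Real.exp (h x - a) :=
          mul_le_mul_of_nonneg_left (Real.add_one_le_exp _) (Real.exp_pos _).le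
      _ = _ := by rw [← Real.exp_add]; congr 1; ring
  refine le_trans ?_ (Finset.sum_le_sum fun x _ => h1 x)
  rw [← Finset.mul_sum, Finset.sum_add_distrib, Finset.sum_sub_distrib]
  simp only [Finset.sum_const, Finset.card_univ, nsmul_eq_mul, mul_one]
  have := Real.exp_pos a
  nlinarith

/-- A message about a family of injections from which, given the later values of any one of them,
one of its first `i + 1` values can often be found, but which does not depend on the order of the
values, has to be long. -/
theorem log_card_message_ge {V U M : Type*} [Fintype V] [DecidableEq V] [Fintype U]
    [DecidableEq U] [Fintype M] {K : ℕ} {P : ℝ} (hP : 1 ≤ P)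
    (hK : K * P ≤ (Fintype.card U : ℝ) - K)
    (mem : (V → Fin K ↪ U) → M) (hmem : ∀ v j i x, mem (swapAt v j i x) = mem x)
    (dec : V → Fin K → M → Finset U → Option U) {q : ℝ}
    (hdec : q * Fintype.card (V → Fin K ↪ U) ≤ ∑ v, ∑ i : Fin K, (1 / ((i : ℝ) + 1)) *
      (Finset.univ.filter fun x : V → Fin K ↪ U =>
        ∃ j ≤ i, dec v i (mem x) ((Finset.Ioi i).map (x v)) = some (x v j)).card) :
    q * Real.log P ≤ Real.log (Fintype.card M) + Fintype.card V := by
  classical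
  have hPpos : 0 < P := by linarith
  have hlog : 0 ≤ Real.log P := Real.log_nonneg hP
  let X := V → Fin K ↪ U
  let hit : X → M → V → Fin K → Prop := fun x m v i =>
    dec v i m ((Finset.Ioi i).map (x v)) = some (x v i)
  let h : X → ℝ := fun x => ∑ v, ∑ i, if hit x (mem x) v i then Real.log P else 0
  have hKU : (K : ℝ) ≤ Fintype.card U := by nlinarith [K.cast_nonneg (α := ℝ)]
  have hne : Nonempty X := by
    have : Nonempty (Fin K ↪ U) := Function.Embedding.nonempty_of_card_le
      (by rw [Fintype.card_fin]; exact_mod_cast hKU)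
    exact ⟨fun _ => this.some⟩
  have hXpos : (0 : ℝ) < Fintype.card X := by exact_mod_cast Fintype.card_pos
  have hMpos : (0 : ℝ) < Fintype.card M := by
    have : Nonempty M := ⟨mem hne.some⟩
    exact_mod_cast Fintype.card_pos
  have hsum : (Fintype.card X : ℝ) * (q * Real.log P) ≤ ∑ x, h x := by
    have e1 : ∑ x, h x = ∑ v, ∑ i, ((Finset.univ.filter fun x : X =>
        hit x (mem x) v i).card : ℝ) * Real.log P := by
      simp only [h]
      rw [Finset.sum_comm]
      refine Finset.sum_congr rfl fun v _ => ?_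
      rw [Finset.sum_comm]
      refine Finset.sum_congr rfl fun i _ => ?_
      rw [← Finset.sum_filter, Finset.sum_const, nsmul_eq_mul]
    have e2 : q * Fintype.card X ≤ ∑ v, ∑ i, ((Finset.univ.filter fun x : X =>
        hit x (mem x) v i).card : ℝ) := by
      refine hdec.trans (Finset.sum_le_sum fun v _ => Finset.sum_le_sum fun i _ => ?_)
      have hle := card_filter_exists_le v i
        (fun x : X => dec v i (mem x) ((Finset.Ioi i).map (x v))) (fun x j hj => by
          rw [hmem, map_swapAt_Ioi v hj])
      rw [one_div, inv_mul_le_iff₀ (by positivity)]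
      exact_mod_cast hle
    rw [e1]
    simp only [← Finset.sum_mul]
    nlinarith [mul_le_mul_of_nonneg_right e2 hlog]
  have h1 := card_mul_exp_le_sum_exp h hsum
  have hexp : ∀ x, Real.exp (h x) = ∏ v, ∏ i, if hit x (mem x) v i then P else 1 := by
    intro x
    simp only [h, Real.exp_sum]
    refine Finset.prod_congr rfl fun v _ => Finset.prod_congr rfl fun i _ => ?_
    split_ifs
    · exact Real.exp_log hPpos
    · exact Real.exp_zero
  -- The actual message is replaced by the sum over all messages. For a fixed `m` the injections at
  -- different `v` are independent, and the moment factorizes.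
  have h2 : ∑ x, Real.exp (h x) ≤
      ∑ m : M, ∑ x : X, ∏ v, ∏ i, if hit x m v i then P else 1 := by
    rw [Finset.sum_comm]
    refine Finset.sum_le_sum fun x _ => ?_
    rw [hexp]
    refine Finset.single_le_sum (f := fun m : M => ∏ v, ∏ i, if hit x m v i then P else 1)
      (fun m _ => Finset.prod_nonneg fun v _ => Finset.prod_nonneg fun i _ => ?_)
      (Finset.mem_univ _)
    split_ifs <;> linarith
  have h3 : ∀ m : M, ∑ x : X, ∏ v, ∏ i, (if hit x m v i then P else 1) ≤
      Real.exp (Fintype.card V) * Fintype.card X := by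
    intro m
    have e := Finset.prod_univ_sum (fun _ : V => (Finset.univ : Finset (Fin K ↪ U)))
      (fun v f => ∏ i, if dec v i m ((Finset.Ioi i).map f) = some (f i) then P else 1)
    rw [Fintype.piFinset_univ] at e
    simp only [hit]
    rw [← e]
    calc _ ≤ ∏ _v : V, (Real.exp 1 * Fintype.card (Fin K ↪ U)) := by
          refine Finset.prod_le_prod (fun v _ => Finset.sum_nonneg fun f _ =>
            Finset.prod_nonneg fun i _ => ?_) fun v _ => sum_prod_guess_le_exp hP K hK _
          split_ifs <;> linarith
      _ = _ := by
          rw [Finset.prod_const, mul_pow, Finset.card_univ, ← Real.exp_nat_mul, mul_one]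
          simp [X]
  have h4 : (Fintype.card X : ℝ) * Real.exp (q * Real.log P) ≤
      Fintype.card M * (Real.exp (Fintype.card V) * Fintype.card X) := by
    refine h1.trans (h2.trans ((Finset.sum_le_sum fun m _ => h3 m).trans ?_))
    rw [Finset.sum_const, nsmul_eq_mul, Finset.card_univ]
  have h5 : Real.exp (q * Real.log P) ≤ Fintype.card M * Real.exp (Fintype.card V) := by
    nlinarith
  have h6 := Real.log_le_log (Real.exp_pos _) h5
  rwa [Real.log_exp, Real.log_mul hMpos.ne' (Real.exp_pos _).ne', Real.log_exp] at h6

/-! ### Streams of insertions followed by deletions -/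

theorem foldl_apply_insert {n : ℕ} (l : List (Finset (Fin n))) (H : Hypergraph n) :
    (l.map Update.insert).foldl Update.apply H = H ∪ l.toFinset := by
  induction l generalizing H with
  | nil => simp
  | cons e l ih =>
    rw [List.map_cons, List.foldl_cons, ih]
    ext a
    simp [Update.apply]

theorem foldl_apply_delete {n : ℕ} (l : List (Finset (Fin n))) (H : Hypergraph n) :
    (l.map Update.delete).foldl Update.apply H = H \ l.toFinset := by
  induction l generalizing H with
  | nil => simp
  | cons e l ih =>
    rw [List.map_cons, List.foldl_cons, ih]
    ext a
    simp [Update.apply]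
    tauto

theorem legalFrom_append {n : ℕ} (L L' : List (Update n)) (H : Hypergraph n) :
    LegalFrom H (L ++ L') ↔ LegalFrom H L ∧ LegalFrom (L.foldl Update.apply H) L' := by
  induction L generalizing H with
  | nil => simp [LegalFrom]
  | cons a L ih => simp [LegalFrom, ih, and_assoc]

theorem legalFrom_map_insert {n : ℕ} (l : List (Finset (Fin n))) (H : Hypergraph n)
    (hl : l.Nodup) (hd : ∀ e ∈ l, e ∉ H) : LegalFrom H (l.map Update.insert) := by
  induction l generalizing H with
  | nil => trivial
  | cons e l ih =>
    rw [List.nodup_cons] at hl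
    refine ⟨hd e (by simp), ih _ hl.2 fun e' he' => ?_⟩
    simp only [Update.apply, Finset.mem_insert, not_or]
    exact ⟨fun h => hl.1 (h ▸ he'), hd e' (by simp [he'])⟩

theorem legalFrom_map_delete {n : ℕ} (l : List (Finset (Fin n))) (H : Hypergraph n)
    (hl : l.Nodup) (hd : ∀ e ∈ l, e ∈ H) : LegalFrom H (l.map Update.delete) := by
  induction l generalizing H with
  | nil => trivial
  | cons e l ih =>
    rw [List.nodup_cons] at hl
    refine ⟨hd e (by simp), ih _ hl.2 fun e' he' => ?_⟩
    simp only [Update.apply, Finset.mem_erase]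
    exact ⟨fun h => hl.1 (h ▸ he'), hd e' (by simp [he'])⟩

/-- The stream that inserts the hyperedges of `E`. -/
noncomputable def insertions {n : ℕ} (E : Hypergraph n) : List (Update n) :=
  E.toList.map Update.insert

/-- The stream that deletes the hyperedges of `D`. -/
noncomputable def deletions {n : ℕ} (D : Hypergraph n) : List (Update n) :=
  D.toList.map Update.delete

theorem length_insertions {n : ℕ} (E : Hypergraph n) : (insertions E).length = E.card := by
  simp [insertions]

theorem length_deletions {n : ℕ} (D : Hypergraph n) : (deletions D).length = D.card := by
  simp [deletions]

theorem finalHypergraph_insertions_append_deletions {n : ℕ} (E D : Hypergraph n) :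
    finalHypergraph (insertions E ++ deletions D) = E \ D := by
  rw [finalHypergraph, List.foldl_append, insertions, deletions, foldl_apply_insert,
    foldl_apply_delete]
  simp

theorem isBoundedDeletionStream_insertions_append_deletions {n k r : ℕ} {E D : Hypergraph n}
    (hD : D ⊆ E) (hE : ∀ e ∈ E, e.card ≤ r) (hk : D.card ≤ k) :
    IsBoundedDeletionStream k r (insertions E ++ deletions D) where
  legal := by
    rw [legalFrom_append]
    refine ⟨legalFrom_map_insert _ _ E.nodup_toList (by simp),
      legalFrom_map_delete _ _ D.nodup_toList fun e he => ?_⟩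
    rw [insertions, foldl_apply_insert]
    simpa using hD (Finset.mem_toList.1 he)
  arity_le := by
    intro a ha
    simp only [insertions, deletions, List.mem_append, List.mem_map, Finset.mem_toList] at ha
    rcases ha with ⟨e, he, rfl⟩ | ⟨e, he, rfl⟩
    · exact hE e he
    · exact hE e (hD he)
  deletions_le := by
    rw [List.countP_append]
    have h1 : (insertions E).countP Update.isDeletion = 0 := by
      rw [List.countP_eq_zero]
      intro a ha
      simp only [insertions, List.mem_map] at ha
      obtain ⟨e, -, rfl⟩ := ha
      simp [Update.isDeletion]
    have h2 := (deletions D).countP_le_length (p := Update.isDeletion)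
    rw [length_deletions] at h2
    omega

namespace StreamingAlgorithm

theorem runFrom_append {n s : ℕ} (A : StreamingAlgorithm.{u} n s) (ω : A.Tape) (t : ℕ)
    (m : Memory s) (L L' : List (Update n)) :
    A.runFrom ω t m (L ++ L') = A.runFrom ω (t + L.length) (A.runFrom ω t m L) L' := by
  induction L generalizing t m with
  | nil => simp [runFrom]
  | cons a L ih =>
    simp only [List.cons_append, runFrom, ih, List.length_cons]
    congr 1
    omega

end StreamingAlgorithm

/-! ### Nonempty cuts and the choice of a tape -/

/-- A cut-sparsifier has a hyperedge in every cut in which the hypergraph has one. -/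
theorem IsCutSparsifier.exists_crosses {n : ℕ} {ε : ℝ} {G : WeightedHypergraph n}
    {H : Hypergraph n} (h : IsCutSparsifier ε G H) (hε : ε < 1) {S e : Finset (Fin n)}
    (he : e ∈ H) (heS : Crosses S e) : ∃ e ∈ G.edges, Crosses S e := by
  by_contra! hcon
  have h0 : G.cutWeight S = 0 := by
    rw [WeightedHypergraph.cutWeight, Finset.filter_false_of_mem hcon, Finset.sum_empty]
  have h1 : 0 < H.toWeighted.cutWeight S := by
    refine Finset.sum_pos (fun _ _ => by simp [Hypergraph.toWeighted]) ⟨e, ?_⟩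
    exact Finset.mem_filter.2 ⟨he, heS⟩
  have h2 := h.lower S
  rw [h0] at h2
  nlinarith [mul_pos (sub_pos.2 hε) h1]

/-- If each of finitely many events has probability at least `q`, then some outcome belongs to
events of at least a fraction `q` of the total weight. -/
theorem exists_sum_filter_ge {Ω ι : Type*} [MeasurableSpace Ω] (μ : Measure Ω)
    [IsProbabilityMeasure μ] [Fintype ι] {w : ι → ℝ} (hw : ∀ i, 0 ≤ w i) (good : ι → Set Ω)
    (hgood : ∀ i, MeasurableSet (good i)) {q : ℝ} (hq : ∀ i, q ≤ μ.real (good i)) :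
    ∃ ω, q * ∑ i, w i ≤ ∑ i, (good i).indicator (fun _ => w i) ω := by
  have hint : ∀ i, Integrable ((good i).indicator fun _ => w i) μ := fun i =>
    (integrable_const (w i)).indicator (hgood i)
  obtain ⟨ω, hω⟩ := exists_integral_le (integrable_finsetSum Finset.univ fun i _ => hint i)
  refine ⟨ω, le_trans ?_ hω⟩
  rw [integral_finsetSum _ fun i _ => hint i, Finset.mul_sum]
  refine Finset.sum_le_sum fun i _ => ?_
  rw [integral_indicator_const _ (hgood i), smul_eq_mul]
  exact mul_le_mul_of_nonneg_right (hq i) (hw i)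

/-! ### The hard hypergraphs and the decoder -/

section Reduction

variable {n : ℕ} {B : Finset (Fin n)} {d K : ℕ}

/-- The hyperedge that joins the vertex `v` to the set `b`. -/
def joinEdge (v : {v // v ∉ B}) (b : {b // b ∈ B.powersetCard d}) : Finset (Fin n) :=
  insert (v : Fin n) (b : Finset (Fin n))

theorem mem_joinEdge_iff (v w : {v // v ∉ B}) (b : {b // b ∈ B.powersetCard d}) :
    (w : Fin n) ∈ joinEdge v b ↔ w = v := by
  have hb := (Finset.mem_powersetCard.1 b.2).1
  rw [joinEdge, Finset.mem_insert, or_iff_left fun h => w.2 (hb h), Subtype.ext_iff]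

theorem joinEdge_injective2 :
    Function.Injective2 (joinEdge : {v // v ∉ B} → {b // b ∈ B.powersetCard d} → _) := by
  intro v w b c h
  have hvw : v = w := by
    rw [← mem_joinEdge_iff w v c, ← h, mem_joinEdge_iff]
  refine ⟨hvw, ?_⟩
  subst hvw
  have hb : (v : Fin n) ∉ (b : Finset (Fin n)) := fun h => v.2 ((Finset.mem_powersetCard.1 b.2).1 h)
  have hc : (v : Fin n) ∉ (c : Finset (Fin n)) := fun h => v.2 ((Finset.mem_powersetCard.1 c.2).1 h)
  apply Subtype.ext
  rw [← Finset.erase_insert hb, ← Finset.erase_insert hc]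
  exact congrArg (fun e => e.erase (v : Fin n)) h

theorem card_joinEdge (v : {v // v ∉ B}) (b : {b // b ∈ B.powersetCard d}) :
    (joinEdge v b).card = d + 1 := by
  obtain ⟨hb, hc⟩ := Finset.mem_powersetCard.1 b.2
  rw [joinEdge, Finset.card_insert_of_notMem fun h => v.2 (hb h), hc]

theorem crosses_joinEdge (hd : 0 < d) (v : {v // v ∉ B}) (b : {b // b ∈ B.powersetCard d}) :
    Crosses {(v : Fin n)} (joinEdge v b) := by
  obtain ⟨hb, hc⟩ := Finset.mem_powersetCard.1 b.2
  refine ⟨⟨v, by simp [joinEdge]⟩, ?_⟩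
  obtain ⟨u, hu⟩ := Finset.card_pos.1 (hc ▸ hd)
  refine ⟨u, ?_⟩
  simp only [joinEdge, Finset.mem_inter, Finset.mem_insert, Finset.mem_compl,
    Finset.mem_singleton]
  exact ⟨Or.inr hu, fun h => v.2 (h ▸ hb hu)⟩

/-- The hyperedges at the vertex `v` given by a set of subsets of `B`. -/
def edgesAt (v : {v // v ∉ B}) (D : Finset {b // b ∈ B.powersetCard d}) : Hypergraph n :=
  D.image (joinEdge v)

/-- The hypergraph given by a family of injections. -/
def familyEdges (x : {v // v ∉ B} → Fin K ↪ {b // b ∈ B.powersetCard d}) : Hypergraph n :=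
  Finset.univ.biUnion fun v => edgesAt v (Finset.univ.map (x v))

theorem joinEdge_mem_edgesAt (v w : {v // v ∉ B}) (b : {b // b ∈ B.powersetCard d})
    (D : Finset {b // b ∈ B.powersetCard d}) :
    joinEdge w b ∈ edgesAt v D ↔ w = v ∧ b ∈ D := by
  rw [edgesAt, Finset.mem_image]
  constructor
  · rintro ⟨c, hc, h⟩
    obtain ⟨rfl, rfl⟩ := joinEdge_injective2 h
    exact ⟨rfl, hc⟩
  · rintro ⟨rfl, h⟩
    exact ⟨b, h, rfl⟩

theorem mem_familyEdges (x : {v // v ∉ B} → Fin K ↪ {b // b ∈ B.powersetCard d})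
    (e : Finset (Fin n)) : e ∈ familyEdges x ↔ ∃ v j, e = joinEdge v (x v j) := by
  simp only [familyEdges, edgesAt, Finset.mem_biUnion, Finset.mem_univ, true_and,
    Finset.mem_image, Finset.mem_map, exists_exists_eq_and]
  simp only [eq_comm]

theorem card_edgesAt (v : {v // v ∉ B}) (D : Finset {b // b ∈ B.powersetCard d}) :
    (edgesAt v D).card = D.card :=
  Finset.card_image_of_injective _ (joinEdge_injective2.right v)

theorem card_familyEdges (x : {v // v ∉ B} → Fin K ↪ {b // b ∈ B.powersetCard d}) :
    (familyEdges x).card = Fintype.card {v // v ∉ B} * K := by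
  rw [familyEdges, Finset.card_biUnion]
  · simp [card_edgesAt]
  · intro v _ w _ hvw
    rw [Function.onFun, Finset.disjoint_left]
    intro e he hf
    obtain ⟨b, -, rfl⟩ := Finset.mem_image.1 he
    exact hvw ((joinEdge_mem_edgesAt w v b _).1 hf).1

theorem familyEdges_swapAt (v : {v // v ∉ B}) (j i : Fin K)
    (x : {v // v ∉ B} → Fin K ↪ {b // b ∈ B.powersetCard d}) :
    familyEdges (swapAt v j i x) = familyEdges x := by
  have h : ∀ w, Finset.univ.map (swapAt v j i x w) = Finset.univ.map (x w) := by
    intro w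
    by_cases hw : w = v
    · subst hw
      simp [swapAt, ← Finset.map_map]
    · simp [swapAt, hw]
  simp only [familyEdges, h]

open Classical in
/-- The neighbourhood of `v` in some hyperedge of `G` that joins `v` to a subset of `B`. -/
noncomputable def neighbourOf (v : {v // v ∉ B}) (G : WeightedHypergraph n) :
    Option {b // b ∈ B.powersetCard d} :=
  if h : ∃ b : {b // b ∈ B.powersetCard d}, joinEdge v b ∈ G.edges then some h.choose else none

/-- The `i`-th hyperedge at `v` survives the deletions, so the cut `{v}` is nonempty. Being a
sub-hypergraph, `G` can only meet it in surviving hyperedges at `v`, which have index at most `i`.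
-/
theorem neighbourOf_isCutSparsifier (hd : 0 < d) {ε : ℝ} (hε : ε < 1)
    (x : {v // v ∉ B} → Fin K ↪ {b // b ∈ B.powersetCard d}) (v : {v // v ∉ B}) (i : Fin K)
    {G : WeightedHypergraph n}
    (hG : IsCutSparsifier ε G (familyEdges x \ edgesAt v ((Finset.Ioi i).map (x v)))) :
    ∃ j ≤ i, neighbourOf v G = some (x v j) := by
  have hi : joinEdge v (x v i) ∈ familyEdges x \ edgesAt v ((Finset.Ioi i).map (x v)) := by
    rw [Finset.mem_sdiff, mem_familyEdges, joinEdge_mem_edgesAt]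
    exact ⟨⟨v, i, rfl⟩, by simp⟩
  obtain ⟨e, he, hcr⟩ := hG.exists_crosses hε hi (crosses_joinEdge hd v _)
  have hve : (v : Fin n) ∈ e := by
    obtain ⟨a, ha⟩ := hcr.1
    rw [Finset.mem_inter, Finset.mem_singleton] at ha
    exact ha.2 ▸ ha.1
  have hex : ∃ b : {b // b ∈ B.powersetCard d}, joinEdge v b ∈ G.edges := by
    obtain ⟨w, j, rfl⟩ := (mem_familyEdges x e).1 (Finset.mem_sdiff.1 (hG.edges_subset he)).1
    rw [mem_joinEdge_iff] at hve
    subst hve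
    exact ⟨_, he⟩
  have hch := hG.edges_subset hex.choose_spec
  rw [Finset.mem_sdiff, mem_familyEdges, joinEdge_mem_edgesAt] at hch
  obtain ⟨⟨w, j, hwj⟩, hnot⟩ := hch
  obtain ⟨rfl, hb⟩ := joinEdge_injective2 hwj
  refine ⟨j, ?_, ?_⟩
  · by_contra hji
    exact hnot ⟨rfl, by rw [hb]; simpa using hji⟩
  · rw [neighbourOf, dif_pos hex, hb]

/-- The space lower bound in terms of the number of hyperedges at each of the vertices outside
`B`. -/
theorem StreamingAlgorithm.Sparsifies.space_ge {n s k : ℕ} {ε : ℝ}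
    {A : StreamingAlgorithm.{u} n s} (hε : ε < 1) (B : Finset (Fin n)) {d K : ℕ} (hd : 0 < d)
    (hA : A.Sparsifies k (d + 1) ε) (hKk : K ≤ k) {P : ℝ} (hP : 1 ≤ P)
    (hK : K * P ≤ (B.card.choose d : ℝ) - K) :
    2 / 3 * ((n - B.card : ℕ) * (harmonic K : ℝ)) * Real.log P ≤
      s * Real.log 2 + (n - B.card : ℕ) := by
  classical
  let V := {v // v ∉ B}
  let U := {b // b ∈ B.powersetCard d}
  have hV : Fintype.card V = n - B.card := by
    simp [V, Fintype.card_subtype_compl]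
  have hU : Fintype.card U = B.card.choose d := by
    rw [Fintype.card_coe, Finset.card_powersetCard]
  let stream : (V → Fin K ↪ U) × V × Fin K → List (Update n) := fun p =>
    insertions (familyEdges p.1) ++ deletions (edgesAt p.2.1 ((Finset.Ioi p.2.2).map (p.1 p.2.1)))
  have hstream : ∀ p, IsBoundedDeletionStream k (d + 1) (stream p) := by
    rintro ⟨x, v, i⟩
    refine isBoundedDeletionStream_insertions_append_deletions ?_ ?_ ?_
    · intro e he
      obtain ⟨b, hb, rfl⟩ := Finset.mem_image.1 he
      obtain ⟨j, -, rfl⟩ := Finset.mem_map.1 hb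
      exact (mem_familyEdges x _).2 ⟨v, j, rfl⟩
    · intro e he
      obtain ⟨v, j, rfl⟩ := (mem_familyEdges x _).1 he
      exact (card_joinEdge v _).le
    · rw [card_edgesAt, Finset.card_map]
      exact (Finset.card_le_univ _).trans (by simpa using hKk)
  choose good hmeas hprob hgood using fun p => hA (stream p) (hstream p)
  let _ := A.tapeSpace
  have := A.law_prob
  -- Fixing one tape makes the algorithm deterministic. The weights `1 / (i + 1)` are the
  -- conditional success probabilities of the symmetry argument and add up to harmonic sums.
  obtain ⟨ω, hω⟩ := exists_sum_filter_ge A.law (q := 2 / 3)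
    (w := fun p : (V → Fin K ↪ U) × V × Fin K => 1 / ((p.2.2 : ℝ) + 1))
    (fun p => by positivity) good hmeas (fun p => by
      have := ENNReal.toReal_mono (measure_ne_top A.law (good p)) (hprob p)
      simpa [Measure.real] using this)
  let mem : (V → Fin K ↪ U) → Memory s := fun x =>
    A.runFrom ω 0 (A.init ω) (insertions (familyEdges x))
  -- All families have the same number of hyperedges, so the decoder knows the clock without knowing
  -- `x`.
  let N := Fintype.card V * K
  let dec : V → Fin K → Memory s → Finset U → Option U := fun v _ m D =>
    neighbourOf v (A.output ω (N + D.card) (A.runFrom ω N m (deletions (edgesAt v D))))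
  have hresult : ∀ x v i, neighbourOf v (A.result ω (stream (x, v, i))) =
      dec v i (mem x) ((Finset.Ioi i).map (x v)) := by
    intro x v i
    simp only [StreamingAlgorithm.result, stream, dec, mem, N, List.length_append,
      length_insertions, length_deletions, card_familyEdges, card_edgesAt,
      StreamingAlgorithm.runFrom_append, Nat.zero_add]
    rfl
  have hharm : ∑ i : Fin K, 1 / ((i : ℝ) + 1) = harmonic K := by
    rw [Fin.sum_univ_eq_sum_range (fun i : ℕ => 1 / ((i : ℝ) + 1)) K, harmonic]
    push_cast
    simp
  have hdec : (2 / 3 * (Fintype.card V * (harmonic K : ℝ))) *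
      Fintype.card (V → Fin K ↪ U) ≤ ∑ v, ∑ i : Fin K, (1 / ((i : ℝ) + 1)) *
      (Finset.univ.filter fun x : V → Fin K ↪ U =>
        ∃ j ≤ i, dec v i (mem x) ((Finset.Ioi i).map (x v)) = some (x v j)).card := by
    have h1 : (2 / 3 * (Fintype.card V * (harmonic K : ℝ))) * Fintype.card (V → Fin K ↪ U) =
        2 / 3 * ∑ p : (V → Fin K ↪ U) × V × Fin K, 1 / ((p.2.2 : ℝ) + 1) := by
      simp only [Fintype.sum_prod_type, hharm, Finset.sum_const, Finset.card_univ, nsmul_eq_mul]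
      ring
    rw [h1]
    refine hω.trans ?_
    rw [Fintype.sum_prod_type_right, Fintype.sum_prod_type]
    refine Finset.sum_le_sum fun v _ => Finset.sum_le_sum fun i _ => ?_
    rw [mul_comm, ← nsmul_eq_mul, ← Finset.sum_const, Finset.sum_filter]
    refine Finset.sum_le_sum fun x _ => ?_
    by_cases hx : ω ∈ good (x, v, i)
    · rw [Set.indicator_of_mem hx, if_pos]
      rw [← hresult]
      refine neighbourOf_isCutSparsifier hd hε x v i ?_
      have := hgood _ ω hx
      rwa [finalHypergraph_insertions_append_deletions] at this
    · rw [Set.indicator_of_notMem hx]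
      split_ifs <;> positivity
  have hfin := log_card_message_ge hP (by rw [hU]; exact hK) mem
    (fun v j i x =>
      congrArg (fun E => A.runFrom ω 0 (A.init ω) (insertions E)) (familyEdges_swapAt v j i x)) dec hdec
  rw [hV] at hfin
  simpa [Memory] using hfin

end Reduction

/-- Some memory is necessary. -/
theorem StreamingAlgorithm.Sparsifies.space_pos {n s k r : ℕ} {ε : ℝ}
    {A : StreamingAlgorithm.{u} n s} (hε : ε < 1) (hn : 2 ≤ n) (hr : 2 ≤ r)
    (hA : A.Sparsifies k r ε) : 0 < s := by
  classical
  by_contra hs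
  obtain rfl : s = 0 := by omega
  let a : Fin n := ⟨0, by omega⟩
  let b : Fin n := ⟨1, by omega⟩
  have hab : a ≠ b := by simp [a, b]
  have hbd : ∀ e : Finset (Fin n), e.card ≤ r → IsBoundedDeletionStream k r [Update.insert e] :=
    fun e he => ⟨⟨by simp [Update.Legal], trivial⟩, by simpa [Update.edge] using he,
      by simp [Update.isDeletion]⟩
  -- Without memory, two streams of the same length get the same output. As `2/3 + 2/3 > 1`, some
  -- tape is good for both, but only the second hypergraph has a hyperedge across `{a}`.
  obtain ⟨g1, hm1, hp1, hg1⟩ := hA _ (hbd {a} (by simp; omega))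
  obtain ⟨g2, hm2, hp2, hg2⟩ := hA _ (hbd {a, b} (by rw [Finset.card_pair hab]; omega))
  let _ := A.tapeSpace
  have := A.law_prob
  have hne : (g1 ∩ g2).Nonempty := by
    by_contra hcon
    rw [Set.not_nonempty_iff_eq_empty, ← Set.disjoint_iff_inter_eq_empty] at hcon
    have h1 := measure_union (μ := A.law) hcon hm2
    have h2 : A.law (g1 ∪ g2) ≤ 1 := prob_le_one
    have h3 : (2 / 3 + 2 / 3 : ℝ≥0∞) ≤ 1 := (add_le_add hp1 hp2).trans (h1 ▸ h2)
    have h4 := ENNReal.toReal_mono ENNReal.one_ne_top h3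
    rw [ENNReal.toReal_add (by simp [ENNReal.div_eq_top]) (by simp [ENNReal.div_eq_top])] at h4
    norm_num at h4
  obtain ⟨ω, h1, h2⟩ := hne
  have hs1 := hg1 ω h1
  have hs2 := hg2 ω h2
  have heq : A.result ω [Update.insert {a}] = A.result ω [Update.insert {a, b}] := by
    simp only [StreamingAlgorithm.result]
    congr 1
    exact Subsingleton.elim _ _
  rw [heq] at hs1
  obtain ⟨e, he, -⟩ := hs2.exists_crosses hε (S := {a}) (e := {a, b})
    (by simp [finalHypergraph, Update.apply])
    ⟨⟨a, by simp⟩, ⟨b, by simp [hab.symm]⟩⟩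
  have e1 := hs1.edges_subset he
  have e2 := hs2.edges_subset he
  simp only [finalHypergraph, List.foldl, Update.apply, Finset.mem_insert, Finset.notMem_empty,
    or_false] at e1 e2
  have : b ∈ ({a} : Finset (Fin n)) := by rw [← e1, e2]; simp
  exact hab (Finset.mem_singleton.1 this).symm

/-! ### Estimates for binomial coefficients and logarithms -/

theorem div_pow_le_choose {m d : ℕ} (h : d ≤ m) : ((m : ℝ) / d) ^ d ≤ m.choose d := by
  induction d generalizing m with
  | zero => simp
  | succ d ih =>
    obtain ⟨m, rfl⟩ : ∃ m', m = m' + 1 := ⟨m - 1, by omega⟩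
    have hdm : d ≤ m := by omega
    have h1 : ((m + 1).choose (d + 1) : ℝ) = (m + 1) / (d + 1) * m.choose d := by
      have := Nat.add_one_mul_choose_eq m d
      rw [div_mul_eq_mul_div, eq_div_iff (by positivity)]
      exact_mod_cast this.symm
    have h2 : (((m : ℝ) + 1) / (d + 1)) ^ d ≤ ((m : ℝ) / d) ^ d := by
      rcases Nat.eq_zero_or_pos d with rfl | hd
      · simp
      · have hd' : (0 : ℝ) < d := by exact_mod_cast hd
        have hdm' : (d : ℝ) ≤ m := by exact_mod_cast hdm
        refine pow_le_pow_left₀ (by positivity) ?_ d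
        rw [div_le_div_iff₀ (by positivity) hd']
        nlinarith
    push_cast
    rw [h1, pow_succ, mul_comm]
    exact mul_le_mul_of_nonneg_left (h2.trans (ih hdm)) (by positivity)

theorem le_choose {m d : ℕ} (h0 : 0 < d) (h : d < m) : m ≤ m.choose d := by
  induction m generalizing d with
  | zero => omega
  | succ m ih =>
    obtain ⟨d, rfl⟩ : ∃ d', d = d' + 1 := ⟨d - 1, by omega⟩
    rw [Nat.choose_succ_succ]
    have h1 : 0 < m.choose (d + 1) := Nat.choose_pos (by omega)
    rcases Nat.eq_zero_or_pos d with rfl | hd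
    · simp
    · have := ih hd (by omega)
      simp only [Nat.succ_eq_add_one]
      omega

/-- With `q = r / n ≤ 1`, multiplication by `q ^ r` bounds the sum by the binomial expansion of `(1
+ q) ^ n ≤ exp r`. -/
theorem log_le_of_le_sum_choose {n r k : ℕ} (hr : 0 < r) (hrn : r ≤ n) (hk : 0 < k)
    (h : k ≤ ∑ i ∈ Finset.range (r + 1), n.choose i) :
    Real.log k ≤ r * (1 + Real.log (n / r)) := by
  have hr' : (0 : ℝ) < r := by exact_mod_cast hr
  have hn' : (0 : ℝ) < n := by exact_mod_cast hr.trans_le hrn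
  have hrn' : (r : ℝ) ≤ n := by exact_mod_cast hrn
  have hk' : (0 : ℝ) < k := by exact_mod_cast hk
  have hq : (r : ℝ) / n ≤ 1 := (div_le_one hn').2 hrn'
  have hq0 : (0 : ℝ) < r / n := by positivity
  have h1 : (k : ℝ) * (r / n) ^ r ≤ Real.exp r := by
    calc (k : ℝ) * (r / n) ^ r
        ≤ (∑ i ∈ Finset.range (r + 1), (n.choose i : ℝ)) * (r / n) ^ r := by
          refine mul_le_mul_of_nonneg_right ?_ (by positivity)
          exact_mod_cast h
      _ ≤ ∑ i ∈ Finset.range (r + 1), (r / n : ℝ) ^ i * 1 ^ (n - i) * n.choose i := by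
          rw [Finset.sum_mul]
          refine Finset.sum_le_sum fun i hi => ?_
          rw [one_pow, mul_one, mul_comm]
          refine mul_le_mul_of_nonneg_right ?_ (by positivity)
          exact pow_le_pow_of_le_one hq0.le hq (by have := Finset.mem_range.1 hi; omega)
      _ ≤ ∑ i ∈ Finset.range (n + 1), (r / n : ℝ) ^ i * 1 ^ (n - i) * n.choose i :=
          Finset.sum_le_sum_of_subset_of_nonneg
            (Finset.range_subset_range.2 (by omega)) fun i _ _ => by positivity
      _ = ((r : ℝ) / n + 1) ^ n := (add_pow _ _ _).symm
      _ ≤ Real.exp (r / n) ^ n :=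
          pow_le_pow_left₀ (by positivity) (Real.add_one_le_exp _) n
      _ = Real.exp r := by
          rw [← Real.exp_nat_mul]
          congr 1
          field_simp
  have h2 := Real.log_le_log (by positivity) h1
  rw [Real.log_exp, Real.log_mul hk'.ne' (by positivity), Real.log_pow,
    Real.log_div hr'.ne' hn'.ne'] at h2
  rw [Real.log_div hn'.ne' hr'.ne']
  linarith

/-- The logarithm of the number of `d`-subsets of a set of about `3 n / 4` elements, compared with
`d` and with the logarithm of the number of subsets of at most `d + 1` of `n` elements. -/
theorem log_choose_ge {n m d k : ℕ} (hd : 0 < d) (hdn : 2 * d ≤ n) (hm : 3 * n ≤ 4 * m)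
    (hk : 0 < k) (h : k ≤ ∑ i ∈ Finset.range (d + 1 + 1), n.choose i) :
    (d : ℝ) ≤ 3 * Real.log (m.choose d) ∧ Real.log k ≤ 10 * Real.log (m.choose d) := by
  have hd' : (0 : ℝ) < d := by exact_mod_cast hd
  have hd1 : (1 : ℝ) ≤ d := by exact_mod_cast hd
  have hdn' : (2 : ℝ) * d ≤ n := by exact_mod_cast hdn
  have hm' : (3 : ℝ) * n ≤ 4 * m := by exact_mod_cast hm
  have hx : (3 / 2 : ℝ) ≤ m / d := by
    rw [le_div_iff₀ hd']
    linarith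
  have hxpos : (0 : ℝ) < m / d := by linarith
  have hlog : d * Real.log (m / d) ≤ Real.log (m.choose d) := by
    have := Real.log_le_log (by positivity) (div_pow_le_choose (m := m) (d := d) (by omega))
    rwa [Real.log_pow] at this
  have hL : (1 / 3 : ℝ) ≤ Real.log (m / d) := by
    have h1 := Real.one_sub_inv_le_log_of_pos hxpos
    have h2 : ((m : ℝ) / d)⁻¹ ≤ (3 / 2 : ℝ)⁻¹ := inv_anti₀ (by norm_num) hx
    norm_num at h2 ⊢
    norm_num at h1
    linarith
  refine ⟨by nlinarith, ?_⟩
  have hlk := log_le_of_le_sum_choose (r := d + 1) (by omega) (by omega) hk h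
  have hn' : (0 : ℝ) < n := by linarith
  have h3 : Real.log (n / (d + 1 : ℕ)) ≤ 1 / 3 + Real.log (m / d) := by
    have h4 : (n : ℝ) / (d + 1 : ℕ) ≤ 4 / 3 * (m / d) := by
      push_cast
      rw [← mul_div_assoc, div_le_div_iff₀ (by positivity) hd']
      nlinarith
    have h5 := Real.log_le_log (by positivity) h4
    rw [Real.log_mul (by norm_num) hxpos.ne'] at h5
    have h6 := Real.log_le_sub_one_of_pos (show (0 : ℝ) < 4 / 3 by norm_num)
    linarith
  push_cast at hlk h3
  -- Since `1/3 ≤ log (m / d)`, the constant `1 + 1/3` costs at most four more copies of `log (m /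
  -- d)`; then `d + 1 ≤ 2 d` gives the factor `10`.
  have h7 : Real.log k ≤ (d + 1) * (5 * Real.log (m / d)) :=
    hlk.trans (mul_le_mul_of_nonneg_left (by linarith) (by positivity))
  nlinarith

/-- With `K` about the square root of `u`, or smaller, the quotient `(u - K) / K` is large. -/
theorem log_quotient_ge {u K : ℕ} (hu : 750 ≤ u) (hK : 0 < K) (hKu : K * K ≤ u) :
    3 ≤ Real.log (((u : ℝ) - K) / K) ∧ Real.log u ≤ 4 * Real.log (((u : ℝ) - K) / K) := by
  have hu' : (750 : ℝ) ≤ u := by exact_mod_cast hu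
  have hK' : (0 : ℝ) < K := by exact_mod_cast hK
  have hKu' : (K : ℝ) * K ≤ u := by exact_mod_cast hKu
  set w := Real.sqrt u with hw
  have hww : w * w = u := Real.mul_self_sqrt (by linarith)
  have hw0 : 0 ≤ w := Real.sqrt_nonneg _
  have hw1 : 27 ≤ w := Real.le_sqrt_of_sq_le (by norm_num; linarith)
  have hKw : (K : ℝ) ≤ w := by nlinarith
  have hP : w - 1 ≤ ((u : ℝ) - K) / K := by
    rw [le_div_iff₀ hK']
    nlinarith
  constructor
  · rw [Real.le_log_iff_exp_le (by linarith)]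
    have h1 : Real.exp 3 = Real.exp 1 ^ 3 := by rw [← Real.exp_nat_mul]; norm_num
    have h2 : Real.exp 1 ^ 3 ≤ 2.72 ^ 3 :=
      pow_le_pow_left₀ (Real.exp_pos _).le (by have := Real.exp_one_lt_d9; linarith) 3
    rw [h1]
    refine h2.trans ?_
    norm_num
    linarith
  -- Here `z` is the fourth root of `u`, and `z ≤ z * z - 1` because `2 ≤ z`.
  · set z := Real.sqrt w with hz
    have hzz : z * z = w := Real.mul_self_sqrt hw0
    have hz0 : 0 ≤ z := Real.sqrt_nonneg _
    have hz2 : 2 ≤ z := Real.le_sqrt_of_sq_le (by norm_num; linarith)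
    have h1 : z ≤ ((u : ℝ) - K) / K := by nlinarith
    have h2 := Real.log_le_log (by linarith) h1
    have h3 : Real.log u = 4 * Real.log z := by
      rw [← hww, ← hzz, Real.log_mul (by positivity) (by positivity),
        Real.log_mul (by positivity) (by positivity)]
      ring
    linarith

/-! ### Choice of parameters and conclusion -/

theorem StreamingAlgorithm.Sparsifies.space_ge_of_large {n s k r : ℕ} {ε : ℝ}
    {A : StreamingAlgorithm.{u} n s} (hε : ε < 1) (hn : 1000 ≤ n) (hr : 2 ≤ r)
    (hrn : (r : ℝ) ≤ (n : ℝ) / 2 + 1) (hk : k ≤ ∑ i ∈ Finset.range (r + 1), n.choose i)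
    (hk0 : 0 < k) (hA : A.Sparsifies k r ε) :
    (n : ℝ) * r * Real.log k ≤ 23040 * s := by
  obtain ⟨d, rfl⟩ : ∃ d, r = d + 1 := ⟨r - 1, by omega⟩
  have hd : 0 < d := by omega
  have hdn : 2 * d ≤ n := by
    have : (2 : ℝ) * d ≤ n := by push_cast at hrn; linarith
    exact_mod_cast this
  obtain ⟨B, -, hB⟩ := Finset.exists_subset_card_eq
    (s := (Finset.univ : Finset (Fin n))) (n := n - n / 4) (by simp)
  set m := n - n / 4 with hm
  have ha : n - m = n / 4 := by omega
  set u := m.choose d with hu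
  have hu750 : 750 ≤ u := le_trans (by omega) (le_choose (m := m) hd (by omega))
  obtain ⟨hdu, hku⟩ := log_choose_ge (m := m) hd hdn (by omega) hk0 hk
  -- At most `k` deletions are allowed, and `K ≤ √u` keeps `log P` comparable to `log u`. The cap is
  -- harmless for the harmonic sum, as `log k ≤ 10 log u`.
  set K := min k (Nat.sqrt u) with hKdef
  have hsqrt : 0 < Nat.sqrt u := Nat.sqrt_pos.2 (by omega)
  have hK0 : 0 < K := lt_min hk0 hsqrt
  have hKK : K * K ≤ u :=
    (Nat.mul_le_mul (min_le_right _ _) (min_le_right _ _)).trans (Nat.sqrt_le u)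
  obtain ⟨hP3, hPu⟩ := log_quotient_ge hu750 hK0 hKK
  have hK' : (0 : ℝ) < K := by exact_mod_cast hK0
  set P := ((u : ℝ) - K) / K with hPdef
  have hP1 : 1 ≤ P := by
    by_contra! hlt
    have h0 : 0 ≤ P := div_nonneg (by
      have : K ≤ u := le_trans (Nat.le_mul_self K) hKK
      have : (K : ℝ) ≤ u := by exact_mod_cast this
      linarith) hK'.le
    have := Real.log_nonpos h0 hlt.le
    linarith
  have main := hA.space_ge hε B hd (min_le_left _ _ : K ≤ k) hP1 (by
    rw [hB, hPdef, mul_div_cancel₀ _ hK'.ne'])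
  rw [hB, ha] at main
  have hH := log_add_one_le_harmonic K
  set H : ℝ := (harmonic K : ℝ) with hHdef
  have hH2 : 0.69 ≤ H := by
    have h1 : Real.log 2 ≤ Real.log ((K + 1 : ℕ) : ℝ) :=
      Real.log_le_log (by norm_num) (by exact_mod_cast Nat.succ_le_succ hK0)
    have := Real.log_two_gt_d9
    norm_num at this ⊢
    linarith
  have hHk : Real.log k ≤ 20 * H := by
    have hk' : (1 : ℝ) ≤ k := by exact_mod_cast hk0
    have hlogk : 0 ≤ Real.log k := Real.log_nonneg hk'
    rcases min_choice k (Nat.sqrt u) with h | h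
    · have h1 : Real.log k ≤ Real.log ((K + 1 : ℕ) : ℝ) := by
        rw [hKdef, h]
        exact Real.log_le_log (by linarith) (by push_cast; linarith)
      linarith
    · have h1 : (u : ℝ) ≤ ((K + 1 : ℕ) : ℝ) * ((K + 1 : ℕ) : ℝ) := by
        rw [hKdef, h]
        exact_mod_cast (Nat.lt_succ_sqrt u).le
      have h2 := Real.log_le_log (by exact_mod_cast (by omega : 0 < u)) h1
      rw [Real.log_mul (by positivity) (by positivity)] at h2
      linarith
  have hlog2 := Real.log_two_lt_d9
  have hs0 : (0 : ℝ) ≤ s := s.cast_nonneg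
  have hslog : (s : ℝ) * Real.log 2 ≤ s := by nlinarith
  have ha8 : (n : ℝ) / 8 ≤ (n / 4 : ℕ) := by
    have : n ≤ 8 * (n / 4) := by omega
    have : (n : ℝ) ≤ 8 * (n / 4 : ℕ) := by exact_mod_cast this
    linarith
  set a : ℝ := ((n / 4 : ℕ) : ℝ) with hadef
  have hn0 : (0 : ℝ) ≤ n := n.cast_nonneg
  have ha0 : 0 ≤ a := by linarith
  -- This absorbs the additive term `a` of `main` into half of `a * (H * Real.log P)`; the
  -- coefficient `2/3 - 1/2 = 1/6` remains.
  have hHP : 2 ≤ H * Real.log P := by nlinarith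
  have h1 : a * (H * Real.log P) ≤ 6 * s := by nlinarith
  have hlogu : 0 ≤ Real.log u := by linarith [(d.cast_nonneg : (0 : ℝ) ≤ d)]
  have h2 : Real.log k * Real.log u ≤ 80 * (H * Real.log P) := by
    calc Real.log k * Real.log u ≤ (20 * H) * (4 * Real.log P) :=
          mul_le_mul hHk hPu hlogu (by linarith)
      _ = _ := by ring
  have hlogk : 0 ≤ Real.log k := Real.log_nonneg (by exact_mod_cast hk0)
  have hr6 : ((d + 1 : ℕ) : ℝ) ≤ 6 * Real.log u := by
    have : (1 : ℝ) ≤ d := by exact_mod_cast hd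
    push_cast
    linarith
  calc (n : ℝ) * (d + 1 : ℕ) * Real.log k
      ≤ (8 * a) * (6 * Real.log u) * Real.log k :=
        mul_le_mul_of_nonneg_right (mul_le_mul (by linarith) hr6 (by positivity) (by linarith))
          hlogk
    _ = 48 * (a * (Real.log k * Real.log u)) := by ring
    _ ≤ 48 * (a * (80 * (H * Real.log P))) := by gcongr
    _ = 3840 * (a * (H * Real.log P)) := by ring
    _ ≤ 3840 * (6 * s) := by gcongr
    _ = 23040 * s := by ring

end HypergraphStream

theorem theorem3 :
    ∃ c : ℝ, 0 < c ∧
      ∀ (n r k s : ℕ) (ε : ℝ),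
        2 ≤ r → (r : ℝ) ≤ (n : ℝ) / 2 + 1 →
        k ≤ ∑ i ∈ Finset.range (r + 1), n.choose i →
        0 < ε → ε < 1 →
        ∀ A : HypergraphStream.StreamingAlgorithm.{u} n s,
          A.Sparsifies k r ε →
            c * ((n : ℝ) * (r : ℝ) * Real.logb 2 ((k : ℝ) / (n : ℝ))) ≤ (s : ℝ) := by
  -- For `n < 1000` the constant covers `n * r * log₂ k ≤ 1000 ^ 3`, and one bit of memory suffices
  -- for the bound. For larger `n` it is far below `1 / (2 * 23040)`.
  refine ⟨1 / 10 ^ 9, by norm_num, fun n r k s ε hr hrn hk _ hε A hA => ?_⟩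
  have hs0 : (0 : ℝ) ≤ s := s.cast_nonneg
  have hr' : (2 : ℝ) ≤ r := by exact_mod_cast hr
  have hn' : (2 : ℝ) ≤ n := by linarith
  have hn2 : 2 ≤ n := by exact_mod_cast hn'
  have hnr : (0 : ℝ) ≤ n * r := by positivity
  -- For `k = 0` the convention `log 0 = 0` makes the left side vanish.
  rcases Nat.eq_zero_or_pos k with rfl | hk0
  · simp
  have hk1 : (1 : ℝ) ≤ k := by exact_mod_cast hk0
  have hlogk : 0 ≤ Real.log k := Real.log_nonneg hk1
  have hle : Real.logb 2 (k / n) ≤ Real.logb 2 k :=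
    Real.logb_le_logb_of_le (by norm_num) (by positivity) (div_le_self (by linarith) (by linarith))
  have hlogb : Real.logb 2 k ≤ 2 * Real.log k := by
    have := Real.log_two_gt_d9
    rw [Real.logb, div_le_iff₀ (by linarith)]
    nlinarith
  have hmul := mul_le_mul_of_nonneg_left hle hnr
  rcases le_or_gt 1000 n with hn | hn
  · have h1 := hA.space_ge_of_large hε hn hr hrn hk hk0
    have h2 := mul_le_mul_of_nonneg_left hlogb hnr
    linarith
  · have hs1 : (1 : ℝ) ≤ s := by exact_mod_cast hA.space_pos hε hn2 hr
    have hrn' : (r : ℝ) ≤ n := by linarith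
    have hrn'' : r ≤ n := by exact_mod_cast hrn'
    have hk2 : k ≤ 2 ^ n := by
      rw [← Nat.sum_range_choose n]
      exact hk.trans (Finset.sum_le_sum_of_subset (Finset.range_subset_range.2 (by omega)))
    have h1 : Real.logb 2 k ≤ n := by
      rw [Real.logb_le_iff_le_rpow (by norm_num) (by linarith), Real.rpow_natCast]
      exact_mod_cast hk2
    have hn3 : (n : ℝ) ≤ 1000 := by exact_mod_cast hn.le
    have h2 : (n : ℝ) * r * Real.logb 2 k ≤ (1000 * 1000) * 1000 :=
      (mul_le_mul_of_nonneg_left h1 hnr).trans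
        (mul_le_mul (mul_le_mul hn3 (hrn'.trans hn3) (by linarith) (by norm_num)) hn3
          (by linarith) (by norm_num))
    linarith
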